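/- Let $M$ be a cusped oriented 3-manifold obtained by gluing finitely many oriented tetrahedra along their faces in pairs, by orientation-reversing face maps (no face being glued to itself), and removing the vertices; here "cusped" means that the link of every vertex is a torus. Let $\tau$ be the resulting ideal triangulation. Assign to each tetrahedron a shape $z\in\mathbb{C}\setminus\{0,1\}$ with $\operatorname{Im} z\ge 0$ (flat tetrahedra, with $z$ real, are allowed). The three pairs of opposite edges of the tetrahedron then carry the parameters $z,\ \frac{1}{1-z},\ 1-\frac1z$ (in this counterclockwise order around each ideal vertex), and the cross-section of the tetrahedron at each ideal vertex is a Euclidean triangle, determined up to size and similar to the triangle with vertices $0,1,z$ (a segment if $z$ is real), whose interior angles are the arguments $\arg\in[0,\pi]$ of these parameters. Suppose that: (a) for every edge of $\tau$, the parameters $z_1,\dots,z_k$ of the $k$ tetrahedra glued around this edge (each tetrahedron counted as often as it is incident to the edge, with its parameter at the corresponding edge of the tetrahedron) satisfy $z_1z_2\cdots z_k=1$; (b) (completeness) the sizes of the cross-sectional triangles can be chosen so that sides glued to each other have equal lengths and the space obtained by gluing all these triangles along their sides is a closed surface (a compact Hausdorff space locally homeomorphic to the plane; its metric is Euclidean except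 possibly for cone points at the vertices). Then for every edge of $\tau$, with $z_1,\dots,z_k$ the parameters around it, $$\arg z_1+\arg z_2+\cdots+\arg z_k=2\pi .$$ -/

import Mathlib

open scoped BigOperators

/-- A finite family of oriented tetrahedra, indexed by `T`, with an orientation-compatible pairing of
all their faces. The vertices of each tetrahedron are labelled `0, 1, 2, 3` according to its
orientation; face `i` is the face opposite to vertex `i`. Face `i` of the tetrahedron `t` is glued to
face `perm t i i` of the tetrahedron `adj t i`, each vertex `j ≠ i` of the face going to the vertex
`perm t i j`. Removing the vertices of the resulting space gives an oriented 3-manifold, of which the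
tetrahedra without their vertices form an ideal triangulation. -/
structure IdealTriangulation (T : Type*) where
  adj : T → Fin 4 → T
  perm : T → Fin 4 → Equiv.Perm (Fin 4)
  adj_adj : ∀ t i, adj (adj t i) (perm t i i) = t
  perm_perm : ∀ t i, perm (adj t i) (perm t i i) = (perm t i)⁻¹
  /-- no face is glued to itself -/
  face_ne : ∀ t i, ¬ (adj t i = t ∧ perm t i i = i)
  /-- the gluing maps reverse the induced orientations of the faces -/
  sign_perm : ∀ t i, Equiv.Perm.sign (perm t i) = -1

/-- The edges of the tetrahedra before the gluing: a tetrahedron and two distinct vertices of it. -/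
abbrev TetEdge (T : Type*) := T × {ε : Sym2 (Fin 4) // ¬ ε.IsDiag}

/-- Pairs of distinct vertices `(v, w)` of a tetrahedron `t`. Such a triple `(t, v, w)` encodes, in the
cross-sectional triangle of `t` at its ideal vertex `v`, both the corner lying on the edge `vw`
and the side lying on the face opposite to `w`. -/
abbrev LinkFlag (T : Type*) := {x : T × Fin 4 × Fin 4 // x.2.1 ≠ x.2.2}

/-- A shape of an ideal tetrahedron: a complex number other than `0` and `1` with nonnegative imaginary
part. The tetrahedron is flat when the imaginary part is zero. -/
def IsShape (z : ℂ) : Prop := z ≠ 0 ∧ z ≠ 1 ∧ 0 ≤ z.im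

/-- The parameter of each edge of an oriented ideal tetrahedron of shape `z`: opposite edges have the
same parameter, and the three edges at a vertex have parameters `z`, `1/(1-z)`, `1-1/z`, in
counterclockwise order on the cross-section. -/
noncomputable def edgeParam (z : ℂ) (ε : Sym2 (Fin 4)) : ℂ :=
  if ε = s(0, 1) ∨ ε = s(2, 3) then z
  else if ε = s(0, 2) ∨ ε = s(1, 3) then 1 / (1 - z)
  else 1 - 1 / z

/-- The corner on the edge `ε` of a cross-section of an oriented ideal tetrahedron of shape `z`, for the
cross-section with corners `0`, `s`, `s * z` in the Euclidean plane `ℂ`, where `s > 0` is its size.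
The interior angle at the corner on `ε` is the argument of `edgeParam z ε`. -/
noncomputable def cornerPos (z : ℂ) (s : ℝ) (ε : Sym2 (Fin 4)) : ℂ :=
  if ε = s(0, 1) ∨ ε = s(2, 3) then 0
  else if ε = s(0, 2) ∨ ε = s(1, 3) then (s : ℂ)
  else (s : ℂ) * z

/-- A closed surface: a compact Hausdorff space that is locally homeomorphic to the plane. -/
def IsClosedSurface (X : Type*) [TopologicalSpace X] : Prop :=
  CompactSpace X ∧ T2Space X ∧
    ∀ x : X, ∃ U : Set X, IsOpen U ∧ x ∈ U ∧ Nonempty (U ≃ₜ EuclideanSpace ℝ (Fin 2))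

namespace IdealTriangulation

variable {T : Type*} (τ : IdealTriangulation T)

/-- Two edges of tetrahedra are identified by the gluing of one face that contains the first of them. -/
def EdgeRel (c d : TetEdge T) : Prop :=
  ∃ i : Fin 4, i ∉ c.2.1 ∧ d.1 = τ.adj c.1 i ∧ d.2.1 = Sym2.map (τ.perm c.1 i) c.2.1

/-- The edges of the triangulation: edges of tetrahedra up to the gluing. -/
def Edge : Type _ := Quot τ.EdgeRel

/-- The edge of the triangulation onto which an edge of a tetrahedron is glued. -/
def toEdge (c : TetEdge T) : τ.Edge := Quot.mk _ c

open Classical in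
/-- The edges of tetrahedra that are glued together to form `e`, one for each of the tetrahedra glued
around `e` (a tetrahedron counts as often as it is incident to `e`). -/
noncomputable def around [Fintype T] (e : τ.Edge) : Finset (TetEdge T) :=
  Finset.univ.filter fun c => τ.toEdge c = e

/-- Two cross-sectional triangles, given by a tetrahedron and a vertex of it, are glued along a side. -/
def LinkTriangleRel (x y : T × Fin 4) : Prop :=
  ∃ i : Fin 4, i ≠ x.2 ∧ y = (τ.adj x.1 i, τ.perm x.1 i x.2)

/-- Two corners of cross-sectional triangles are identified by the gluing of one side. -/
def LinkVertexRel (x y : LinkFlag T) : Prop :=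
  ∃ i : Fin 4, i ≠ x.1.2.1 ∧ i ≠ x.1.2.2 ∧
    y.1 = (τ.adj x.1.1 i, τ.perm x.1.1 i x.1.2.1, τ.perm x.1.1 i x.1.2.2)

/-- Two sides of cross-sectional triangles are glued to each other. -/
def LinkSideRel (x y : LinkFlag T) : Prop :=
  y.1 = (τ.adj x.1.1 x.1.2.2, τ.perm x.1.1 x.1.2.2 x.1.2.1, τ.perm x.1.1 x.1.2.2 x.1.2.2)

/-- The ideal vertices (cusps) of the glued space. The link of a cusp is the closed, connected, oriented
surface tiled by the cross-sectional triangles of the class. -/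
def Cusp : Type _ := Quot τ.LinkTriangleRel

/-- The vertices of the tilings of the links. -/
def LinkVertex : Type _ := Quot τ.LinkVertexRel

/-- The edges of the tilings of the links. -/
def LinkSide : Type _ := Quot τ.LinkSideRel

/-- The cusp at which a cross-sectional triangle lies. -/
def toCusp (x : T × Fin 4) : τ.Cusp := Quot.mk _ x

/-- The cusp whose link contains a given vertex. -/
def LinkVertex.cusp : τ.LinkVertex → τ.Cusp :=
  Quot.lift (fun x => τ.toCusp (x.1.1, x.1.2.1)) (by
    rintro x y ⟨i, hi, -, hy⟩
    exact Quot.sound ⟨i, hi, by rw [hy]⟩)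

/-- The cusp whose link contains a given side. -/
def LinkSide.cusp : τ.LinkSide → τ.Cusp :=
  Quot.lift (fun x => τ.toCusp (x.1.1, x.1.2.1)) (by
    intro x y hy
    exact Quot.sound ⟨x.1.2.2, x.2.symm, by rw [show y.1 = _ from hy]⟩)

/-- The Euler characteristic (vertices minus edges plus faces) of the link of a cusp. -/
noncomputable def linkEulerChar (q : τ.Cusp) : ℤ :=
  (Nat.card {a : τ.LinkVertex // LinkVertex.cusp τ a = q} : ℤ)
    - (Nat.card {a : τ.LinkSide // LinkSide.cusp τ a = q} : ℤ)
    + (Nat.card {x : T × Fin 4 // τ.toCusp x = q} : ℤ)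

/-- The tetrahedra glue up to a cusped 3-manifold: the link of every ideal vertex is a torus, that is,
this closed connected oriented surface has Euler characteristic zero. -/
def IsCusped : Prop := ∀ q : τ.Cusp, τ.linkEulerChar q = 0

section CrossSection

variable (z : T → ℂ) (size : T × Fin 4 → ℝ)

/-- The corner on the edge `vw` of the cross-sectional triangle at `x = (t, v)`. -/
noncomputable def corner (x : T × Fin 4) (w : Fin 4) : ℂ :=
  cornerPos (z x.1) (size x) s(x.2, w)

/-- The Euclidean cross-sectional triangle at `x = (t, v)` (a segment if `t` is flat). -/
noncomputable def triangle (x : T × Fin 4) : Set ℂ :=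
  convexHull ℝ (corner z size x '' {w | w ≠ x.2})

/-- The disjoint union of the cross-sectional triangles. -/
abbrev TrianglePoint : Type _ := (x : T × Fin 4) × triangle z size x

/-- The sizes of the triangles match: sides that are glued to each other have equal lengths. -/
def SidesMatch : Prop :=
  ∀ (t : T) (v i a b : Fin 4), i ≠ v → a ≠ v → a ≠ i → b ≠ v → b ≠ i →
    dist (corner z size (t, v) a) (corner z size (t, v) b) =
      dist (corner z size (τ.adj t i, τ.perm t i v) (τ.perm t i a))
        (corner z size (τ.adj t i, τ.perm t i v) (τ.perm t i b))

/-- Two points are identified when they correspond under the affine map between two glued sides. -/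
def PointRel (p q : TrianglePoint z size) : Prop :=
  ∃ (t : T) (v i a b : Fin 4) (r : ℝ), i ≠ v ∧ a ≠ v ∧ a ≠ i ∧ b ≠ v ∧ b ≠ i ∧ a ≠ b ∧
    r ∈ Set.Icc (0 : ℝ) 1 ∧
    p.1 = (t, v) ∧
    (p.2 : ℂ) = AffineMap.lineMap (corner z size (t, v) a) (corner z size (t, v) b) r ∧
    q.1 = (τ.adj t i, τ.perm t i v) ∧
    (q.2 : ℂ) = AffineMap.lineMap (corner z size (τ.adj t i, τ.perm t i v) (τ.perm t i a))
      (corner z size (τ.adj t i, τ.perm t i v) (τ.perm t i b)) r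

/-- The space obtained by gluing the Euclidean cross-sectional triangles at all ideal vertices. -/
abbrev CrossSection : Type _ := Quot (τ.PointRel z size)

end CrossSection

/-- Completeness: the Euclidean cross-sectional triangles, in suitable sizes, fit together along their
sides and give a closed surface. The metric of the surface is Euclidean except for possible cone points
at the vertices. -/
def IsComplete (z : T → ℂ) : Prop :=
  ∃ size : T × Fin 4 → ℝ, (∀ x, 0 < size x) ∧ τ.SidesMatch z size ∧
    IsClosedSurface (τ.CrossSection z size)

end IdealTriangulation

/-! The proof is a count of angles. Since the parameters around an edge have product 1, their
arguments add up to a nonnegative multiple of `2π`. Each tetrahedron contributes `2π` in total, and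
vanishing Euler characteristic of the links makes edges and tetrahedra equal in number
(`card_edge`). So the average angle sum per edge is `2π`, and it suffices that no sum is zero
(`sum_arg_eq_two_pi`).

The count needs every edge to have two distinct ends in the links. This comes from orientation: seen
from the other end, turning around the edge changes direction, so rotation and reversal of flags
form a dihedral action (`mk_reverseFlag_ne`).

Completeness rules out the sum zero (`exists_arg_ne_zero`). If all angles at a link vertex vanish,
each triangle there is a segment on a ray from its corner, and the gluing identifies these rays near
the vertex. Distance to the vertex then embeds an open set of the cross-section continuously into
the line, which is impossible in a surface (`not_isClosedSurface`). -/

/-! ### Free involutions, dihedral actions and turning around an edge -/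

/-- A map to a type whose fibres are the orbits of a free involution is two-to-one. -/
theorem card_eq_two_mul_of_fibres {α β : Type*} [Finite α] (g : α → β) (hg : Function.Surjective g)
    (f : α → α) (hf : ∀ a, f a ≠ a) (hgf : ∀ a b, g b = g a ↔ b = a ∨ b = f a) :
    Nat.card α = 2 * Nat.card β := by
  classical
  have := Fintype.ofFinite α
  have : Finite β := Finite.of_surjective g hg
  have := Fintype.ofFinite β
  rw [Nat.card_eq_fintype_card, Nat.card_eq_fintype_card, ← Finset.card_univ,
    Finset.card_eq_sum_card_fiberwise (f := g) (t := Finset.univ) (by simp)]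
  rw [Finset.sum_congr rfl (g := fun _ => 2), Finset.sum_const, Finset.card_univ, smul_eq_mul,
    mul_comm]
  intro b _
  obtain ⟨a, rfl⟩ := hg b
  rw [Finset.card_eq_two]
  refine ⟨a, f a, (hf a).symm, ?_⟩
  ext b
  simp [hgf]

/-- In a dihedral action in which neither the reflection `I` nor `R⁻¹ * I` fixes a point, the
reflection moves every rotation orbit to another one. -/
theorem zpow_apply_ne_of_dihedral {α : Type*} (R I : Equiv.Perm α) (hIR : ∀ a, R (I (R (I a))) = a)
    (hI : ∀ a, I (I a) = a) (hI' : ∀ a, I a ≠ a) (hRI : ∀ a, R a ≠ I a) (n : ℤ) (a : α) :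
    (R ^ n) a ≠ I a := by
  have hinv : I⁻¹ = I := by
    ext a; rw [Equiv.Perm.inv_eq_iff_eq, hI]
  have hconj : I * R * I⁻¹ = R⁻¹ := by
    rw [hinv, eq_inv_iff_mul_eq_one]
    ext a
    exact R.injective (hIR (R a))
  have hz (m : ℤ) (b : α) : I ((R ^ m) b) = (R ^ (-m)) (I b) := by
    have h : I * R ^ m = R ^ (-m) * I := by
      rw [zpow_neg, ← inv_zpow, ← hconj, conj_zpow, inv_mul_cancel_right]
    exact congrArg (fun σ : Equiv.Perm α => σ b) h
  intro h
  -- Move halfway along the orbit: with `n = 2m` the point `(R ^ m) a` is fixed by `I`, and with `n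
  -- = 2m + 1` it has the same image under `R` and `I`.
  obtain ⟨m, rfl | rfl⟩ := Int.even_or_odd' n
  · apply hI' ((R ^ m) a)
    rw [hz, ← h, ← Equiv.Perm.mul_apply, ← zpow_add]
    congr 2; ring
  · apply hRI ((R ^ m) a)
    rw [hz, ← h, ← Equiv.Perm.mul_apply, ← Equiv.Perm.mul_apply, ← zpow_add, ← zpow_one_add]
    congr 2; ring

/-- The face met first when turning counterclockwise around the edge `vw` of an oriented tetrahedron:
`(v, w, turnFace v w, turnFace w v)` is an even permutation of the vertices. -/
def turnFace : Fin 4 → Fin 4 → Fin 4 :=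
  ![![0, 2, 3, 1], ![3, 0, 0, 2], ![1, 3, 0, 0], ![2, 0, 1, 0]]

theorem eq_turnFace_or : ∀ v w i : Fin 4, v ≠ w → i ≠ v → i ≠ w →
    i = turnFace v w ∨ i = turnFace w v := by decide

/-- An odd `σ` makes the even arrangement `(v, w, turnFace v w, turnFace w v)` odd; exchanging its
last two entries makes it even again. -/
theorem turnFace_map : ∀ σ : Equiv.Perm (Fin 4), Equiv.Perm.sign σ = -1 → ∀ v w : Fin 4, v ≠ w →
    turnFace (σ v) (σ w) = σ (turnFace w v) := by
  decide +kernel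

/-! ### Flags, vertices of the links and ends of edges -/

namespace IdealTriangulation

variable {T : Type*} (τ : IdealTriangulation T)

/-- The flag at the other end of the same edge of the tetrahedron. -/
def reverseFlag (c : LinkFlag T) : LinkFlag T := ⟨(c.1.1, c.1.2.2, c.1.2.1), c.2.symm⟩

@[simp] theorem reverseFlag_reverseFlag (c : LinkFlag T) : reverseFlag (reverseFlag c) = c := rfl

/-- The image of a flag under the gluing map of a face. -/
def glueFlag (c : LinkFlag T) (i : Fin 4) : LinkFlag T :=
  ⟨(τ.adj c.1.1 i, τ.perm c.1.1 i c.1.2.1, τ.perm c.1.1 i c.1.2.2),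
    fun h => c.2 ((τ.perm c.1.1 i).injective h)⟩

/-- Turning counterclockwise around a vertex of a link. -/
def turn (c : LinkFlag T) : LinkFlag T := τ.glueFlag c (turnFace c.1.2.1 c.1.2.2)

theorem glueFlag_glueFlag (c : LinkFlag T) (i : Fin 4) :
    τ.glueFlag (τ.glueFlag c i) (τ.perm c.1.1 i i) = c := by
  apply Subtype.ext
  simp [glueFlag, τ.adj_adj, τ.perm_perm]

/-- The dihedral relation: a counterclockwise turn seen from one end of an edge is clockwise seen
from the other. -/
theorem turn_reverseFlag_turn_reverseFlag (c : LinkFlag T) :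
    τ.turn (reverseFlag (τ.turn (reverseFlag c))) = c := by
  have h : τ.turn (reverseFlag (τ.turn (reverseFlag c))) =
      τ.glueFlag (τ.glueFlag c (turnFace c.1.2.2 c.1.2.1))
        (turnFace (τ.perm c.1.1 (turnFace c.1.2.2 c.1.2.1) c.1.2.1)
          (τ.perm c.1.1 (turnFace c.1.2.2 c.1.2.1) c.1.2.2)) := rfl
  rw [h, turnFace_map _ (τ.sign_perm _ _) _ _ c.2, glueFlag_glueFlag]

/-- Reversal as a permutation of the flags. -/
def reversePerm : Equiv.Perm (LinkFlag T) := ⟨reverseFlag, reverseFlag, fun _ => rfl, fun _ => rfl⟩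

/-- Turning as a permutation of the flags. -/
def turnPerm : Equiv.Perm (LinkFlag T) where
  toFun := τ.turn
  invFun c := reverseFlag (τ.turn (reverseFlag c))
  left_inv c := by
    have h := τ.turn_reverseFlag_turn_reverseFlag (reverseFlag c)
    simp only [reverseFlag_reverseFlag] at h
    change reverseFlag (τ.turn (reverseFlag (τ.turn c))) = c
    rw [h, reverseFlag_reverseFlag]
  right_inv c := τ.turn_reverseFlag_turn_reverseFlag c

theorem reverseFlag_ne (c : LinkFlag T) : reverseFlag c ≠ c := by
  intro h
  exact c.2 (congrArg (fun d : LinkFlag T => d.1.2.2) h)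

/-- Otherwise the gluing map would exchange `v` and `w`, and by `turnFace_map` it would glue the
face to itself. -/
theorem turn_ne_reverseFlag (c : LinkFlag T) : τ.turn c ≠ reverseFlag c := by
  obtain ⟨⟨t, v, w⟩, hvw⟩ := c
  intro h
  have h1 : τ.adj t (turnFace v w) = t := congrArg (fun d : LinkFlag T => d.1.1) h
  have h2 : τ.perm t (turnFace v w) v = w := congrArg (fun d : LinkFlag T => d.1.2.1) h
  have h3 : τ.perm t (turnFace v w) w = v := congrArg (fun d : LinkFlag T => d.1.2.2) h
  apply τ.face_ne t (turnFace v w)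
  refine ⟨h1, ?_⟩
  have := turnFace_map _ (τ.sign_perm t (turnFace v w)) w v hvw.symm
  rw [h2, h3] at this
  exact this.symm

theorem linkVertexRel_iff (c d : LinkFlag T) :
    τ.LinkVertexRel c d ↔ ∃ i, i ≠ c.1.2.1 ∧ i ≠ c.1.2.2 ∧ d = τ.glueFlag c i := by
  simp only [LinkVertexRel, glueFlag, Subtype.ext_iff]

/-- The vertex of the tiling of a link at which a corner of a cross-section lies. -/
def toVertex (c : LinkFlag T) : τ.LinkVertex := Quot.mk _ c

theorem toVertex_glueFlag (c : LinkFlag T) {i : Fin 4} (h1 : i ≠ c.1.2.1) (h2 : i ≠ c.1.2.2) :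
    τ.toVertex (τ.glueFlag c i) = τ.toVertex c :=
  (Quot.sound ((τ.linkVertexRel_iff _ _).2 ⟨i, h1, h2, rfl⟩)).symm

/-- Only two faces contain a given edge of a tetrahedron, and crossing them is a turn or an inverse
turn; link vertices are thus rotation orbits. -/
theorem exists_zpow_of_mk_eq {c d : LinkFlag T}
    (h : τ.toVertex c = τ.toVertex d) : ∃ n : ℤ, (τ.turnPerm ^ n) c = d := by
  have h' := Quot.eqvGen_exact h
  clear h
  induction h' with
  | rel c d h =>
    obtain ⟨i, h1, h2, rfl⟩ := (τ.linkVertexRel_iff _ _).1 h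
    obtain rfl | rfl := eq_turnFace_or _ _ _ c.2 h1 h2
    · exact ⟨1, rfl⟩
    · exact ⟨-1, rfl⟩
  | refl c => exact ⟨0, rfl⟩
  | symm c d _ ih =>
    obtain ⟨n, rfl⟩ := ih
    exact ⟨-n, by rw [zpow_neg, Equiv.Perm.inv_eq_iff_eq]⟩
  | trans c d e _ _ ih1 ih2 =>
    obtain ⟨n, rfl⟩ := ih1
    obtain ⟨m, rfl⟩ := ih2
    exact ⟨m + n, by rw [zpow_add, Equiv.Perm.mul_apply]⟩

theorem mk_reverseFlag_ne (c : LinkFlag T) :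
    τ.toVertex (reverseFlag c) ≠ τ.toVertex c := by
  intro h
  obtain ⟨n, hn⟩ := τ.exists_zpow_of_mk_eq h.symm
  exact zpow_apply_ne_of_dihedral τ.turnPerm reversePerm τ.turn_reverseFlag_turn_reverseFlag
    reverseFlag_reverseFlag reverseFlag_ne τ.turn_ne_reverseFlag n c hn

/-- The edge of the tetrahedron on which a corner of a cross-section lies. -/
def flagEdge (c : LinkFlag T) : TetEdge T := (c.1.1, ⟨s(c.1.2.1, c.1.2.2), by simpa using c.2⟩)

theorem flagEdge_surjective : Function.Surjective (flagEdge (T := T)) := by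
  rintro ⟨t, ⟨ε, hε⟩⟩
  induction ε using Sym2.ind with
  | _ v w => exact ⟨⟨(t, v, w), by simpa using hε⟩, rfl⟩

theorem flagEdge_eq_iff (c d : LinkFlag T) :
    flagEdge c = flagEdge d ↔ c = d ∨ c = reverseFlag d := by
  obtain ⟨⟨t, v, w⟩, h⟩ := c
  obtain ⟨⟨t', v', w'⟩, h'⟩ := d
  simp [flagEdge, reverseFlag]
  tauto

theorem flagEdge_reverseFlag (c : LinkFlag T) : flagEdge (reverseFlag c) = flagEdge c :=
  (flagEdge_eq_iff _ _).2 (Or.inr rfl)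

theorem edgeRel_flagEdge {c : LinkFlag T} {y : TetEdge T} :
    τ.EdgeRel (flagEdge c) y ↔ ∃ i, i ≠ c.1.2.1 ∧ i ≠ c.1.2.2 ∧ y = flagEdge (τ.glueFlag c i) := by
  obtain ⟨⟨t, v, w⟩, h⟩ := c
  obtain ⟨t', ⟨ε, hε⟩⟩ := y
  simp [EdgeRel, flagEdge, glueFlag, and_assoc]

/-- The edge of the triangulation on which a vertex of a link lies. -/
def vertexEdge : τ.LinkVertex → τ.Edge :=
  Quot.lift (fun c => τ.toEdge (flagEdge c)) (by
    intro c d h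
    obtain ⟨i, h1, h2, rfl⟩ := (τ.linkVertexRel_iff _ _).1 h
    exact Quot.sound (τ.edgeRel_flagEdge.2 ⟨i, h1, h2, rfl⟩))

/-- The other end of the edge on which a vertex of a link lies. -/
def reverseVertex : τ.LinkVertex → τ.LinkVertex :=
  Quot.map reverseFlag (by
    intro c d h
    obtain ⟨i, h1, h2, rfl⟩ := (τ.linkVertexRel_iff _ _).1 h
    exact (τ.linkVertexRel_iff _ _).2 ⟨i, h2, h1, rfl⟩)

theorem reverseVertex_reverseVertex (a : τ.LinkVertex) :
    τ.reverseVertex (τ.reverseVertex a) = a := by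
  induction a using Quot.ind
  rfl

/-- An edge of a tetrahedron has just two flags, exchanged by reversal. The claim for all choices of
flags propagates along the chain of gluings, so an edge has at most two ends. -/
theorem mk_eq_or_of_toEdge_eq {x y : TetEdge T} (h : τ.toEdge x = τ.toEdge y) (c d : LinkFlag T)
    (hc : flagEdge c = x) (hd : flagEdge d = y) :
    τ.toVertex c = τ.toVertex d ∨
      τ.toVertex c = τ.reverseVertex (τ.toVertex d) := by
  have h' := Quot.eqvGen_exact h
  clear h
  induction h' generalizing c d with
  | rel x y h =>
    subst hc
    obtain ⟨i, h1, h2, rfl⟩ := τ.edgeRel_flagEdge.1 h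
    have h3 : τ.toVertex c = τ.toVertex (τ.glueFlag c i) :=
      (τ.toVertex_glueFlag c h1 h2).symm
    rw [h3]
    obtain rfl | rfl := (flagEdge_eq_iff _ _).1 hd
    · exact Or.inl rfl
    · exact Or.inr rfl
  | refl x =>
    subst hc
    obtain rfl | rfl := (flagEdge_eq_iff _ _).1 hd
    · exact Or.inl rfl
    · exact Or.inr rfl
  | symm x y _ ih =>
    obtain h | h := ih d c hd hc
    · exact Or.inl h.symm
    · exact Or.inr (by rw [h, reverseVertex_reverseVertex])
  | trans x y w _ _ ih1 ih2 =>
    obtain ⟨m, hm⟩ := flagEdge_surjective y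
    obtain h1 | h1 := ih1 c m hc hm <;> obtain h2 | h2 := ih2 m d hm hd
    · exact Or.inl (h1.trans h2)
    · exact Or.inr (h1.trans h2)
    · exact Or.inr (by rw [h1, h2])
    · exact Or.inl (by rw [h1, h2, reverseVertex_reverseVertex])

theorem glueFlag_side_involutive (c : LinkFlag T) :
    τ.glueFlag (τ.glueFlag c c.1.2.2) (τ.glueFlag c c.1.2.2).1.2.2 = c :=
  τ.glueFlag_glueFlag c c.1.2.2

theorem linkSideRel_iff (c d : LinkFlag T) : τ.LinkSideRel c d ↔ d = τ.glueFlag c c.1.2.2 := by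
  simp only [LinkSideRel, glueFlag, Subtype.ext_iff]

/-! ### Counting the cells of the links -/

section Counting

variable [Fintype T]

instance : Finite τ.LinkVertex := Quot.finite _

instance : Finite τ.LinkSide := Quot.finite _

instance : Finite τ.Cusp := Quot.finite _

instance : Finite τ.Edge := Quot.finite _

theorem card_linkVertex : Nat.card τ.LinkVertex = 2 * Nat.card τ.Edge := by
  apply card_eq_two_mul_of_fibres τ.vertexEdge _ τ.reverseVertex
  · intro a
    induction a using Quot.ind
    exact τ.mk_reverseFlag_ne _
  · intro a b
    induction a using Quot.ind with | _ c
    induction b using Quot.ind with | _ d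
    constructor
    · intro h
      exact τ.mk_eq_or_of_toEdge_eq h d c rfl rfl
    · rintro (h | h)
      · rw [h]
      · rw [h]
        change τ.toEdge (flagEdge (reverseFlag c)) = τ.toEdge (flagEdge c)
        rw [flagEdge_reverseFlag]
  · intro e
    induction e using Quot.ind with | _ x
    obtain ⟨c, rfl⟩ := flagEdge_surjective x
    exact ⟨Quot.mk _ c, rfl⟩

theorem card_linkFlag : Nat.card (LinkFlag T) = 12 * Fintype.card T := by
  have e : LinkFlag T ≃ T × {y : Fin 4 × Fin 4 // y.1 ≠ y.2} :=
    ⟨fun c => (c.1.1, ⟨c.1.2, c.2⟩), fun c => ⟨(c.1, c.2.1), c.2.2⟩, fun _ => rfl, fun _ => rfl⟩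
  have h : Fintype.card {y : Fin 4 × Fin 4 // y.1 ≠ y.2} = 12 := by decide
  rw [Nat.card_congr e, Nat.card_eq_fintype_card, Fintype.card_prod, h, mul_comm]

/-- Gluing pairs the `12` sides per tetrahedron without fixed points, because no face is glued to
itself. -/
theorem card_linkSide : Nat.card τ.LinkSide = 6 * Fintype.card T := by
  have h : Nat.card (LinkFlag T) = 2 * Nat.card τ.LinkSide := by
    apply card_eq_two_mul_of_fibres (fun c => (Quot.mk _ c : τ.LinkSide)) Quot.mk_surjective
      (fun c => τ.glueFlag c c.1.2.2)
    · intro c h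
      apply τ.face_ne c.1.1 c.1.2.2
      exact ⟨congrArg (fun d : LinkFlag T => d.1.1) h, congrArg (fun d : LinkFlag T => d.1.2.2) h⟩
    · intro c d
      constructor
      · intro h
        have h' := Quot.eqvGen_exact h
        clear h
        induction h' with
        | rel x y h =>
          rw [linkSideRel_iff] at h
          exact Or.inr (by rw [h, glueFlag_side_involutive])
        | refl x => exact Or.inl rfl
        | symm x y _ ih =>
          obtain rfl | rfl := ih
          · exact Or.inl rfl
          · exact Or.inr (by rw [glueFlag_side_involutive])
        | trans x y w _ _ ih1 ih2 =>
          obtain rfl | rfl := ih1 <;> obtain rfl | rfl := ih2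
          · exact Or.inl rfl
          · exact Or.inr rfl
          · exact Or.inr rfl
          · exact Or.inl (by rw [glueFlag_side_involutive])
      · rintro (rfl | rfl)
        · rfl
        · exact (Quot.sound ((τ.linkSideRel_iff _ _).2 rfl)).symm
  rw [card_linkFlag] at h
  omega

theorem card_eq_sum_card_fibre {α β : Type*} [Finite α] [Fintype β] (f : α → β) :
    (Nat.card α : ℤ) = ∑ b, (Nat.card {a // f a = b} : ℤ) := by
  rw [← Nat.card_congr (Equiv.sigmaFiberEquiv f), Nat.card_sigma]
  push_cast
  rfl

/-- An ideal triangulation of a cusped manifold has as many edges as tetrahedra. -/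
theorem card_edge (hτ : τ.IsCusped) : Nat.card τ.Edge = Fintype.card T := by
  have := Fintype.ofFinite τ.Cusp
  -- Over all cusps, with `E` edges and `N` tetrahedra, the sum is `2E - 6N + 4N`.
  have h : ∑ q, τ.linkEulerChar q = 0 := Finset.sum_eq_zero fun q _ => hτ q
  simp only [linkEulerChar, Finset.sum_add_distrib, Finset.sum_sub_distrib,
    ← card_eq_sum_card_fibre] at h
  rw [card_linkVertex, card_linkSide, Nat.card_prod, Nat.card_eq_fintype_card (α := T),
    Nat.card_eq_fintype_card (α := Fin 4), Fintype.card_fin] at h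
  push_cast at h
  omega

end Counting

end IdealTriangulation

/-! ### Angles of a single tetrahedron -/

theorem edgeParam_ne_zero {z : ℂ} (hz : IsShape z) (ε : Sym2 (Fin 4)) : edgeParam z ε ≠ 0 := by
  obtain ⟨h0, h1, -⟩ := hz
  have h1' : 1 - z ≠ 0 := sub_ne_zero.2 h1.symm
  unfold edgeParam
  split_ifs
  · exact h0
  · exact one_div_ne_zero h1'
  · rw [sub_ne_zero, ne_eq, eq_div_iff h0, one_mul]
    exact h1

theorem edgeParam_im_nonneg {z : ℂ} (hz : IsShape z) (ε : Sym2 (Fin 4)) :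
    0 ≤ (edgeParam z ε).im := by
  obtain ⟨h0, h1, h2⟩ := hz
  unfold edgeParam
  split_ifs
  · exact h2
  · rw [one_div, Complex.inv_im]
    apply div_nonneg _ (Complex.normSq_nonneg _)
    simpa using h2
  · rw [one_div, Complex.sub_im, Complex.inv_im, Complex.one_im, zero_sub, ← neg_div, neg_neg]
    exact div_nonneg h2 (Complex.normSq_nonneg _)

theorem arg_edgeParam_nonneg {z : ℂ} (hz : IsShape z) (ε : Sym2 (Fin 4)) :
    0 ≤ (edgeParam z ε).arg :=
  Complex.arg_nonneg_iff.2 (edgeParam_im_nonneg hz ε)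

theorem Complex.coe_sum_arg {ι : Type*} (s : Finset ι) (f : ι → ℂ) (hf : ∀ i ∈ s, f i ≠ 0) :
    ((∑ i ∈ s, (f i).arg : ℝ) : Real.Angle) = ((∏ i ∈ s, f i).arg : Real.Angle) := by
  classical
  induction s using Finset.induction_on with
  | empty => simp
  | insert a s ha ih =>
    rw [Finset.sum_insert ha, Finset.prod_insert ha, Real.Angle.coe_add,
      ih fun i hi => hf i (Finset.mem_insert_of_mem hi), Complex.arg_mul_coe_angle]
    · exact hf a (Finset.mem_insert_self a s)
    · exact Finset.prod_ne_zero_iff.2 fun i hi => hf i (Finset.mem_insert_of_mem hi)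

/-- The angles of a Euclidean triangle, possibly degenerate, add up to `π`. -/
theorem sum_arg_shape {z : ℂ} (hz : IsShape z) :
    z.arg + (1 / (1 - z)).arg + (1 - 1 / z).arg = Real.pi := by
  have h0 := hz.1
  have h1 : 1 - z ≠ 0 := sub_ne_zero.2 hz.2.1.symm
  have e1 : edgeParam z s(0, 2) = 1 / (1 - z) := by simp [edgeParam]
  have e2 : edgeParam z s(0, 3) = 1 - 1 / z := by simp [edgeParam]
  have n1 := edgeParam_ne_zero hz s(0, 2)
  have n2 := edgeParam_ne_zero hz s(0, 3)
  have p1 := arg_edgeParam_nonneg hz s(0, 2)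
  have p2 := arg_edgeParam_nonneg hz s(0, 3)
  rw [e1] at n1 p1
  rw [e2] at n2 p2
  have p0 : 0 ≤ z.arg := Complex.arg_nonneg_iff.2 hz.2.2
  -- The three parameters have product `-1`, so the sum is `π` modulo `2π`; bounds then single out
  -- `π`.
  have hsum : ((z.arg + (1 / (1 - z)).arg + (1 - 1 / z).arg : ℝ) : Real.Angle) = Real.pi := by
    rw [Real.Angle.coe_add, Real.Angle.coe_add, ← Complex.arg_mul_coe_angle h0 n1,
      ← Complex.arg_mul_coe_angle (mul_ne_zero h0 n1) n2]
    have : z * (1 / (1 - z)) * (1 - 1 / z) = -1 := by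
      field_simp
      ring
    rw [this, Complex.arg_neg_one]
  obtain ⟨k, hk⟩ := Real.Angle.angle_eq_iff_two_pi_dvd_sub.1 hsum
  have hpi := Real.pi_pos
  have q0 := Complex.arg_le_pi z
  have q1 := Complex.arg_le_pi (1 / (1 - z))
  have q2 := Complex.arg_le_pi (1 - 1 / z)
  -- This excludes the sum `3π`: if `z` is a negative real, then `1 / (1 - z)` is positive and has
  -- argument zero.
  have hlt : z.arg + (1 / (1 - z)).arg < 2 * Real.pi := by
    rcases q0.lt_or_eq with h | h
    · linarith
    · obtain ⟨hre, him⟩ := Complex.arg_eq_pi_iff.1 h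
      have : (1 / (1 - z)).arg = 0 := by
        obtain ⟨x, y⟩ := z
        simp only at hre him
        subst him
        have : (1 / (1 - (⟨x, 0⟩ : ℂ))) = ((1 / (1 - x) : ℝ) : ℂ) := by
          push_cast
          rfl
        rw [this, Complex.arg_ofReal_of_nonneg]
        apply one_div_nonneg.2
        linarith
      linarith
  have hk0 : k = 0 := by
    have h1 : (-1 : ℝ) < k := by nlinarith
    have h2 : (k : ℝ) < 1 := by nlinarith
    have h1' : -1 < k := by exact_mod_cast h1
    have h2' : k < 1 := by exact_mod_cast h2
    omega
  rw [hk0] at hk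
  simp only [Int.cast_zero, mul_zero] at hk
  linarith

/-- Each angle of the cross-section occurs on two opposite edges, whence twice `π`. -/
theorem sum_arg_edgeParam {z : ℂ} (hz : IsShape z) :
    ∑ ε : {ε : Sym2 (Fin 4) // ¬ ε.IsDiag}, (edgeParam z ε).arg = 2 * Real.pi := by
  have huniv : (Finset.univ : Finset {ε : Sym2 (Fin 4) // ¬ ε.IsDiag}) =
      {⟨s(0, 1), by decide⟩, ⟨s(2, 3), by decide⟩, ⟨s(0, 2), by decide⟩, ⟨s(1, 3), by decide⟩,
        ⟨s(0, 3), by decide⟩, ⟨s(1, 2), by decide⟩} := by decide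
  rw [huniv, Finset.sum_insert (by decide), Finset.sum_insert (by decide),
    Finset.sum_insert (by decide), Finset.sum_insert (by decide), Finset.sum_insert (by decide),
    Finset.sum_singleton]
  have e1 : edgeParam z s(0, 1) = z := by simp [edgeParam]
  have e2 : edgeParam z s(2, 3) = z := by simp [edgeParam]
  have e3 : edgeParam z s(0, 2) = 1 / (1 - z) := by simp [edgeParam]
  have e4 : edgeParam z s(1, 3) = 1 / (1 - z) := by simp [edgeParam]
  have e5 : edgeParam z s(0, 3) = 1 - 1 / z := by simp [edgeParam]
  have e6 : edgeParam z s(1, 2) = 1 - 1 / z := by simp [edgeParam]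
  rw [e1, e2, e3, e4, e5, e6]
  linarith [sum_arg_shape hz]

/-! ### Angle sums around the edges -/

namespace IdealTriangulation

variable {T : Type*} [Fintype T] (τ : IdealTriangulation T)

theorem sum_edges_sum_around [Fintype τ.Edge] (f : TetEdge T → ℝ) :
    ∑ e, ∑ c ∈ τ.around e, f c = ∑ c, f c := by
  classical
  rw [← Finset.sum_fiberwise Finset.univ τ.toEdge]
  refine Finset.sum_congr rfl fun e _ => Finset.sum_congr ?_ fun _ _ => rfl
  ext c
  simp [around]

/-- If there are as many edges as tetrahedra and no edge has total angle zero, then the total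
angle around every edge is `2π`. -/
theorem sum_arg_eq_two_pi (hcard : Nat.card τ.Edge = Fintype.card T)
    {z : T → ℂ} (hz : ∀ t, IsShape (z t))
    (hprod : ∀ e : τ.Edge, ∏ c ∈ τ.around e, edgeParam (z c.1) c.2.1 = 1)
    (hpos : ∀ e : τ.Edge, ∃ c ∈ τ.around e, (edgeParam (z c.1) c.2.1).arg ≠ 0) (e : τ.Edge) :
    ∑ c ∈ τ.around e, (edgeParam (z c.1) c.2.1).arg = 2 * Real.pi := by
  have := Fintype.ofFinite τ.Edge
  have hpi := Real.pi_pos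
  have hle (e : τ.Edge) : 2 * Real.pi ≤ ∑ c ∈ τ.around e, (edgeParam (z c.1) c.2.1).arg := by
    have h := Complex.coe_sum_arg (τ.around e) (fun c => edgeParam (z c.1) c.2.1)
      fun c _ => edgeParam_ne_zero (hz c.1) _
    rw [hprod e, Complex.arg_one, Real.Angle.angle_eq_iff_two_pi_dvd_sub] at h
    obtain ⟨k, hk⟩ := h
    obtain ⟨c, hc, hc0⟩ := hpos e
    have hlt : 0 < ∑ c ∈ τ.around e, (edgeParam (z c.1) c.2.1).arg :=
      Finset.sum_pos' (fun c _ => arg_edgeParam_nonneg (hz c.1) _)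
        ⟨c, hc, (arg_edgeParam_nonneg (hz c.1) _).lt_of_ne' hc0⟩
    rw [sub_zero] at hk
    rw [hk] at hlt ⊢
    have h1 : (0 : ℝ) < k := by
      by_contra! h
      nlinarith
    have h2 : (1 : ℝ) ≤ k := by exact_mod_cast (show 0 < k by exact_mod_cast h1)
    nlinarith
  -- Every term is at least `2π` and the totals agree, so every inequality is an equality.
  have htotal : ∑ e, ∑ c ∈ τ.around e, (edgeParam (z c.1) c.2.1).arg =
      ∑ _e : τ.Edge, 2 * Real.pi := by
    rw [sum_edges_sum_around, Fintype.sum_prod_type]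
    simp only [sum_arg_edgeParam (hz _), Finset.sum_const, Finset.card_univ]
    rw [← hcard, Nat.card_eq_fintype_card]
  exact ((Finset.sum_eq_sum_iff_of_le fun e _ => hle e).1 htotal.symm e (Finset.mem_univ e)).symm

end IdealTriangulation

/-! ### Surfaces do not embed locally into the line -/

section Surface

/-- There is no injective continuous function on the plane. -/
theorem not_injective_of_continuous_plane {f : EuclideanSpace ℝ (Fin 2) → ℝ} (hf : Continuous f) :
    ¬ Function.Injective f := by
  intro hinj
  have hrank : 1 < Module.rank ℝ (EuclideanSpace ℝ (Fin 2)) := by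
    rw [← Module.finrank_eq_rank, finrank_euclideanSpace_fin]
    exact_mod_cast one_lt_two
  -- The plane without `y` is connected, so its image contains the intermediate value `f y`, against
  -- injectivity.
  have key {x y w : EuclideanSpace ℝ (Fin 2)} (h1 : f x < f y) (h2 : f y < f w) : False := by
    have hconn := ((isConnected_compl_singleton_of_one_lt_rank hrank y).image f
      hf.continuousOn).isPreconnected
    obtain ⟨u, hu, huy⟩ := hconn.Icc_subset
      (Set.mem_image_of_mem f (show x ∈ ({y}ᶜ : Set _) from fun h => h1.ne (congrArg f h)))
      (Set.mem_image_of_mem f (show w ∈ ({y}ᶜ : Set _) from fun h => h2.ne' (congrArg f h)))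
      ⟨h1.le, h2.le⟩
    exact hu (hinj huy)
  have hne {m n : ℕ} (h : m ≠ n) : f (EuclideanSpace.single 0 (m : ℝ)) ≠
      f (EuclideanSpace.single 0 (n : ℝ)) := by
    intro h'
    have h2 := congrArg (fun u : EuclideanSpace ℝ (Fin 2) => u 0) (hinj h')
    simp at h2
    exact h h2
  have h01 := hne zero_ne_one
  have h12 := hne (m := 1) (n := 2) (by norm_num)
  have h02 := hne (m := 0) (n := 2) (by norm_num)
  rcases h01.lt_or_gt with a | a <;> rcases h12.lt_or_gt with b | b <;>
    rcases h02.lt_or_gt with c | c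
  · exact key a b
  · exact key a b
  · exact key c b
  · exact key c a
  · exact key a c
  · exact key b c
  · exact key b a
  · exact key b a

/-- No nonempty open subset of a surface embeds continuously into the line. -/
theorem IsClosedSurface.not_injOn {X : Type*} [TopologicalSpace X] (hX : IsClosedSurface X)
    {F : X → ℝ} (hF : Continuous F) {V : Set X} (hV : IsOpen V) {x : X} (hx : x ∈ V) :
    ¬ Set.InjOn F V := by
  intro hinj
  obtain ⟨-, -, hX⟩ := hX
  obtain ⟨U, -, hxU, ⟨h⟩⟩ := hX x
  have hg : Continuous fun y => (h.symm y : X) := continuous_subtype_val.comp h.symm.continuous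
  obtain ⟨r, hr, hball⟩ := Metric.isOpen_iff.1 (hV.preimage hg) (h ⟨x, hxU⟩) (by simpa using hx)
  -- This chart parametrizes a ball inside `V` by the whole plane.
  set φ := OpenPartialHomeomorph.univBall (h ⟨x, hxU⟩) r
  have hφ (y) : φ y ∈ Metric.ball (h ⟨x, hxU⟩) r := by
    rw [← OpenPartialHomeomorph.univBall_target _ hr]
    exact φ.map_source (by simp [φ])
  have hφc : Continuous φ := OpenPartialHomeomorph.continuous_univBall _ _
  apply not_injective_of_continuous_plane (hF.comp (hg.comp hφc))
  intro y y' hy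
  have h1 := hinj (hball (hφ y)) (hball (hφ y')) hy
  have h2 := h.symm.injective (Subtype.ext h1)
  exact φ.injOn (by simp [φ]) (by simp [φ]) h2

end Surface

/-! ### Corners of the cross-sectional triangles -/

section Corner

theorem cornerPos_ne {z : ℂ} (hz : IsShape z) {s : ℝ} (hs : 0 < s) :
    ∀ {v a b : Fin 4}, a ≠ v → b ≠ v → a ≠ b → cornerPos z s s(v, a) ≠ cornerPos z s s(v, b) := by
  obtain ⟨h0, h1, -⟩ := hz
  have hs' : (s : ℂ) ≠ 0 := by exact_mod_cast hs.ne'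
  intro v a b
  fin_cases v <;> fin_cases a <;> fin_cases b <;> simp [cornerPos, h0, h1, hs', hs'.symm]

/-- The parameter at a corner is the ratio of the two sides that meet there. -/
theorem cornerPos_sub {z : ℂ} (hz : IsShape z) (s : ℝ) :
    ∀ {v w a b : Fin 4}, w ≠ v → a ≠ v → b ≠ v → a ≠ w → b ≠ w → a ≠ b →
      cornerPos z s s(v, a) - cornerPos z s s(v, w) =
        edgeParam z s(v, w) * (cornerPos z s s(v, b) - cornerPos z s s(v, w)) ∨
      cornerPos z s s(v, b) - cornerPos z s s(v, w) =
        edgeParam z s(v, w) * (cornerPos z s s(v, a) - cornerPos z s s(v, w)) := by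
  obtain ⟨h0, h1, -⟩ := hz
  have h1' : 1 - z ≠ 0 := sub_ne_zero.2 h1.symm
  -- These are the ratios of sides at the corners `0`, `s` and `s * z`; all labellings reduce to
  -- them.
  have e1 : (s * z : ℂ) = z * s := mul_comm _ _
  have e2 : -(s : ℂ) = (1 - z)⁻¹ * (s * z - s) := by field_simp; ring
  have e3 : (s : ℂ) - s * z = -((1 - z⁻¹) * (s * z)) := by field_simp; ring
  intro v w a b
  fin_cases v <;> fin_cases w <;> fin_cases a <;> fin_cases b <;>
    simp [cornerPos, edgeParam] <;>
    first
      | exact Or.inl e1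
      | exact Or.inr e1
      | exact Or.inl e2
      | exact Or.inr e2
      | exact Or.inl e3
      | exact Or.inr e3

/-- At a corner of angle zero the two sides have the same direction. -/
theorem exists_cornerPos_sub {z : ℂ} (hz : IsShape z) (s : ℝ) {v w a b : Fin 4}
    (hw : w ≠ v) (ha : a ≠ v) (hb : b ≠ v) (haw : a ≠ w) (hbw : b ≠ w) (hab : a ≠ b)
    (harg : (edgeParam z s(v, w)).arg = 0) : ∃ k : ℝ, 0 < k ∧
      cornerPos z s s(v, a) - cornerPos z s s(v, w) =
        k • (cornerPos z s s(v, b) - cornerPos z s s(v, w)) := by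
  have hne := edgeParam_ne_zero hz s(v, w)
  have h := cornerPos_sub hz s hw ha hb haw hbw hab
  obtain ⟨hre, him⟩ := Complex.arg_eq_zero_iff.1 harg
  obtain ⟨r, hr⟩ : ∃ r : ℝ, edgeParam z s(v, w) = r := ⟨_, Complex.ext rfl him⟩
  rw [hr] at hre hne h
  rw [Complex.ofReal_re] at hre
  have hr0 : r ≠ 0 := by exact_mod_cast hne
  have hrpos : 0 < r := hre.lt_of_ne' hr0
  obtain h | h := h
  · exact ⟨r, hrpos, by rw [Complex.real_smul, h]⟩
  · refine ⟨r⁻¹, inv_pos.2 hrpos, ?_⟩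
    rw [h, Complex.real_smul, ← mul_assoc, ← Complex.ofReal_mul, inv_mul_cancel₀ hr0,
      Complex.ofReal_one, one_mul]

theorem Fin.eq_of_four : ∀ v i a b w : Fin 4, i ≠ v → a ≠ v → a ≠ i → b ≠ v → b ≠ i → a ≠ b →
    w = v ∨ w = i ∨ w = a ∨ w = b := by decide

theorem Fin.exists_two_others : ∀ v w : Fin 4, w ≠ v → ∃ a b : Fin 4,
    a ≠ v ∧ b ≠ v ∧ a ≠ w ∧ b ≠ w ∧ a ≠ b := by decide

end Corner

/-! ### Link vertices where all angles vanish -/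

namespace IdealTriangulation

variable {T : Type*} (τ : IdealTriangulation T)

/-- The flag `(t, v, w)`, where `x = (t, v)`, lies at the vertex `κ` of a link. -/
def IsAt (κ : τ.LinkVertex) (x : T × Fin 4) (w : Fin 4) : Prop :=
  ∃ h : x.2 ≠ w, τ.toVertex ⟨(x.1, x.2, w), h⟩ = κ

theorem isAt_glue_iff (κ : τ.LinkVertex) {t : T} {v w i : Fin 4} (hiv : i ≠ v) (hiw : i ≠ w) :
    τ.IsAt κ (τ.adj t i, τ.perm t i v) (τ.perm t i w) ↔ τ.IsAt κ (t, v) w := by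
  constructor
  · rintro ⟨h, rfl⟩
    have h' : v ≠ w := fun h' => h (congrArg (τ.perm t i) h')
    exact ⟨h', (τ.toVertex_glueFlag ⟨(t, v, w), h'⟩ hiv hiw).symm⟩
  · rintro ⟨h, rfl⟩
    exact ⟨fun h' => h ((τ.perm t i).injective h'), τ.toVertex_glueFlag ⟨(t, v, w), h⟩ hiv hiw⟩

/-- All angles at the vertex `κ` of a link vanish, and `δ` is a lower bound for the lengths of all
sides of the cross-sectional triangles. -/
structure IsThinVertex (z : T → ℂ) (size : T × Fin 4 → ℝ) (κ : τ.LinkVertex) (δ : ℝ) : Prop where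
  shape : ∀ t, IsShape (z t)
  sidesMatch : τ.SidesMatch z size
  thin : ∀ x w, τ.IsAt κ x w → (edgeParam (z x.1) s(x.2, w)).arg = 0
  pos : 0 < δ
  le_dist : ∀ x a b, a ≠ x.2 → b ≠ x.2 → a ≠ b → δ ≤ dist (corner z size x a) (corner z size x b)

/-- The distance to the nearest corner at the vertex `κ`, truncated at `δ`. -/
noncomputable def vertexDist (z : T → ℂ) (size : T × Fin 4 → ℝ) (κ : τ.LinkVertex) (δ : ℝ)
    (p : TrianglePoint z size) : ℝ :=
  open Classical in
  -- The cap `δ` makes the function compatible with the gluing: a point on a side may be opposite to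
  -- a corner at `κ` in one triangle only, and there the distance is at least `δ`.
  ⨅ w, if τ.IsAt κ p.1 w then min δ (dist (p.2 : ℂ) (corner z size p.1 w)) else δ

theorem continuous_vertexDist (z : T → ℂ) (size : T × Fin 4 → ℝ) (κ : τ.LinkVertex) (δ : ℝ) :
    Continuous (τ.vertexDist z size κ δ) := by
  refine continuous_sigma fun x => ?_
  simp only [vertexDist, ← Finset.inf'_univ_eq_ciInf]
  refine Continuous.finset_inf'_apply _ fun w _ => ?_
  split_ifs
  · fun_prop
  · fun_prop

variable {τ} {z : T → ℂ} {size : T × Fin 4 → ℝ} {κ : τ.LinkVertex} {δ : ℝ}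

theorem mem_triangle_of_mem_side {x : T × Fin 4} {a b : Fin 4} (ha : a ≠ x.2) (hb : b ≠ x.2)
    {r : ℝ} (hr : r ∈ Set.Icc (0 : ℝ) 1) :
    AffineMap.lineMap (corner z size x a) (corner z size x b) r ∈ triangle z size x :=
  (convex_convexHull ℝ _).lineMap_mem
    (subset_convexHull ℝ _ (Set.mem_image_of_mem (corner z size x) ha))
    (subset_convexHull ℝ _ (Set.mem_image_of_mem (corner z size x) hb)) hr

theorem exists_mem_side {x : T × Fin 4} {w b : Fin 4} (hw : w ≠ x.2) (hb : b ≠ x.2) {d : ℝ}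
    (hd0 : 0 ≤ d) (hdpos : 0 < dist (corner z size x w) (corner z size x b))
    (hd : d ≤ dist (corner z size x w) (corner z size x b)) :
    ∃ r ∈ Set.Icc (0 : ℝ) 1, ∃ p : triangle z size x,
      (p : ℂ) = AffineMap.lineMap (corner z size x w) (corner z size x b) r ∧
        dist (p : ℂ) (corner z size x w) = d := by
  have hr : d / dist (corner z size x w) (corner z size x b) ∈ Set.Icc (0 : ℝ) 1 :=
    ⟨div_nonneg hd0 hdpos.le, (div_le_one hdpos).2 hd⟩
  refine ⟨_, hr, ⟨_, mem_triangle_of_mem_side hw hb hr⟩, rfl, ?_⟩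
  rw [dist_lineMap_left, Real.norm_of_nonneg hr.1, div_mul_cancel₀ _ hdpos.ne']

theorem exists_of_vertexDist_lt {p : TrianglePoint z size} (h : τ.vertexDist z size κ δ p < δ) :
    ∃ w, τ.IsAt κ p.1 w ∧
      dist (p.2 : ℂ) (corner z size p.1 w) = τ.vertexDist z size κ δ p := by
  classical
  obtain ⟨w, hw⟩ := exists_eq_ciInf_of_finite (f := fun w =>
    if τ.IsAt κ p.1 w then min δ (dist (p.2 : ℂ) (corner z size p.1 w)) else δ)
  have hw' : (if τ.IsAt κ p.1 w then min δ (dist (p.2 : ℂ) (corner z size p.1 w)) else δ) =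
      τ.vertexDist z size κ δ p := by
    rw [vertexDist]
    convert hw
  rw [← hw'] at h ⊢
  split_ifs at h ⊢ with hat
  · refine ⟨w, hat, ?_⟩
    rcases min_lt_iff.1 h with h | h
    · exact absurd h (lt_irrefl _)
    · exact (min_eq_right h.le).symm
  · exact absurd h (lt_irrefl _)

namespace IsThinVertex

variable (H : τ.IsThinVertex z size κ δ)

include H

theorem exists_corner_sub {x : T × Fin 4} {w a b : Fin 4} (hw : τ.IsAt κ x w) (ha : a ≠ x.2)
    (hb : b ≠ x.2) (haw : a ≠ w) (hbw : b ≠ w) (hab : a ≠ b) : ∃ k : ℝ, 0 < k ∧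
      corner z size x a - corner z size x w = k • (corner z size x b - corner z size x w) :=
  exists_cornerPos_sub (H.shape x.1) _ hw.1.symm ha hb haw hbw hab (H.thin x w hw)

/-- A triangle with an angle zero lies on a ray that starts at the corner. -/
theorem exists_of_mem_triangle {x : T × Fin 4} {w b : Fin 4} (hw : τ.IsAt κ x w) (hb : b ≠ x.2)
    (hbw : b ≠ w) {q : ℂ} (hq : q ∈ triangle z size x) : ∃ r : ℝ, 0 ≤ r ∧
      q = AffineMap.lineMap (corner z size x w) (corner z size x b) r := by
  have hconv : Convex ℝ {q : ℂ | ∃ r : ℝ, 0 ≤ r ∧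
      q = AffineMap.lineMap (corner z size x w) (corner z size x b) r} := by
    have : {q : ℂ | ∃ r : ℝ, 0 ≤ r ∧
        q = AffineMap.lineMap (corner z size x w) (corner z size x b) r} =
        (AffineMap.lineMap (corner z size x w) (corner z size x b) : ℝ →ᵃ[ℝ] ℂ) ''
          Set.Ici 0 := by
      ext q
      simp only [Set.mem_ofPred_eq, Set.mem_image, Set.mem_Ici, eq_comm]
    rw [this]
    exact (convex_Ici 0).affine_image _
  refine convexHull_min ?_ hconv hq
  rintro _ ⟨a, ha, rfl⟩
  by_cases haw : a = w
  · exact ⟨0, le_rfl, by rw [AffineMap.lineMap_apply_zero, haw]⟩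
  by_cases hab : a = b
  · exact ⟨1, zero_le_one, by rw [AffineMap.lineMap_apply_one, hab]⟩
  obtain ⟨k, hk, h⟩ := H.exists_corner_sub hw ha hb haw hbw hab
  refine ⟨k, hk.le, ?_⟩
  rw [AffineMap.lineMap_apply, vsub_eq_sub, vadd_eq_add, ← h, sub_add_cancel]

/-- On a ray, the distance from the origin is a coordinate. -/
theorem eq_of_dist_eq {x : T × Fin 4} {w : Fin 4} (hw : τ.IsAt κ x w)
    {p q : triangle z size x}
    (h : dist (p : ℂ) (corner z size x w) = dist (q : ℂ) (corner z size x w)) : p = q := by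
  obtain ⟨b, -, hb, -, hbw, -, -⟩ := Fin.exists_two_others x.2 w hw.1.symm
  obtain ⟨r, hr, hp⟩ := H.exists_of_mem_triangle hw hb hbw p.2
  obtain ⟨r', hr', hq⟩ := H.exists_of_mem_triangle hw hb hbw q.2
  have hpos := H.pos.trans_le (H.le_dist x w b hw.1.symm hb hbw.symm)
  rw [hp, hq, dist_lineMap_left, dist_lineMap_left, Real.norm_of_nonneg hr,
    Real.norm_of_nonneg hr'] at h
  apply Subtype.ext
  rw [hp, hq, mul_right_cancel₀ hpos.ne' h]

/-- The side opposite to a corner of angle zero keeps the distance `δ` from it. -/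
theorem le_dist_opposite {x : T × Fin 4} {w a b : Fin 4} (hw : τ.IsAt κ x w) (ha : a ≠ x.2)
    (hb : b ≠ x.2) (haw : a ≠ w) (hbw : b ≠ w) (hab : a ≠ b) {r : ℝ}
    (hr : r ∈ Set.Icc (0 : ℝ) 1) :
    δ ≤ dist (AffineMap.lineMap (corner z size x a) (corner z size x b) r)
      (corner z size x w) := by
  obtain ⟨k, hk, h⟩ := H.exists_corner_sub hw ha hb haw hbw hab
  have h1 := H.le_dist x a w ha hw.1.symm haw
  have h2 := H.le_dist x b w hb hw.1.symm hbw
  rw [dist_eq_norm, h, norm_smul, Real.norm_of_nonneg hk.le] at h1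
  rw [dist_eq_norm] at h2
  have h3 : AffineMap.lineMap (corner z size x a) (corner z size x b) r - corner z size x w =
      ((1 - r) * k + r) • (corner z size x b - corner z size x w) := by
    rw [AffineMap.lineMap_apply_module, add_smul, mul_smul, ← h]
    simp only [Complex.real_smul]
    push_cast
    ring
  have hr1 : 0 ≤ 1 - r := sub_nonneg.2 hr.2
  rw [dist_eq_norm, h3, norm_smul, Real.norm_of_nonneg
    (add_nonneg (mul_nonneg hr1 hk.le) hr.1)]
  nlinarith [mul_le_mul_of_nonneg_left h1 hr1, mul_le_mul_of_nonneg_left h2 hr.1]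

/-- The gluing map matches the terms of the two infima: distances to the ends of the glued side
agree by `sidesMatch`, and the remaining terms equal `δ`. -/
theorem vertexDist_eq_of_pointRel {p q : TrianglePoint z size} (h : τ.PointRel z size p q) :
    τ.vertexDist z size κ δ p = τ.vertexDist z size κ δ q := by
  obtain ⟨x, p⟩ := p
  obtain ⟨y, q⟩ := q
  obtain ⟨t, v, i, a, b, r, hiv, hav, hai, hbv, hbi, hab, hr, hx, hp, hy, hq⟩ := h
  dsimp only at hx hp hy hq
  subst hx hy
  have hinj {j k : Fin 4} (h : j ≠ k) : τ.perm t i j ≠ τ.perm t i k :=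
    fun h' => h ((τ.perm t i).injective h')
  unfold vertexDist
  dsimp only
  refine Equiv.iInf_congr (τ.perm t i) fun w => ?_
  rw [hp, hq]
  have hside := H.sidesMatch t v i a b hiv hav hai hbv hbi
  obtain rfl | rfl | rfl | rfl := Fin.eq_of_four v i a b w hiv hav hai hbv hbi hab
  · rw [if_neg fun h => h.1 rfl, if_neg fun h => h.1 rfl]
  · trans δ
    · split_ifs with h
      · exact min_eq_left (H.le_dist_opposite h (hinj hav) (hinj hbv) (hinj hai) (hinj hbi)
          (hinj hab) hr)
      · rfl
    · split_ifs with h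
      · exact (min_eq_left (H.le_dist_opposite h hav hbv hai hbi hab hr)).symm
      · rfl
  · simp only [dist_lineMap_left, hside]
    classical
    exact if_congr (τ.isAt_glue_iff κ hiv hai.symm) rfl rfl
  · simp only [dist_lineMap_right, hside]
    classical
    exact if_congr (τ.isAt_glue_iff κ hiv hbi.symm) rfl rfl

/-- The points at a given small distance from the corners at a vertex where all angles vanish are
identified with each other. -/
theorem mk_eq_of_dist_eq {d : ℝ} (hd0 : 0 ≤ d) (hd : d < δ) {c c' : LinkFlag T}
    (hcc : Relation.EqvGen τ.LinkVertexRel c c') (hc : τ.toVertex c = κ)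
    (p : triangle z size (c.1.1, c.1.2.1)) (p' : triangle z size (c'.1.1, c'.1.2.1))
    (hp : dist (p : ℂ) (corner z size (c.1.1, c.1.2.1) c.1.2.2) = d)
    (hp' : dist (p' : ℂ) (corner z size (c'.1.1, c'.1.2.1) c'.1.2.2) = d) :
    (Quot.mk _ ⟨_, p⟩ : τ.CrossSection z size) = Quot.mk _ ⟨_, p'⟩ := by
  have hex (x : T × Fin 4) {w b : Fin 4} (hw : w ≠ x.2) (hb : b ≠ x.2) (hbw : b ≠ w) :=
    exists_mem_side (z := z) (size := size) hw hb hd0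
      (H.pos.trans_le (H.le_dist x w b hw hb hbw.symm))
      (hd.le.trans (H.le_dist x w b hw hb hbw.symm))
  induction hcc with
  | rel c c' h =>
    obtain ⟨⟨t, v, w⟩, hvw⟩ := c
    obtain ⟨i, hiv, hiw, rfl⟩ := (τ.linkVertexRel_iff _ _).1 h
    dsimp only at hiv hiw hvw p hp
    obtain ⟨b, hbv, hbi, hbw⟩ : ∃ b : Fin 4, b ≠ v ∧ b ≠ i ∧ b ≠ w := by
      clear * -
      revert v i w
      decide
    obtain ⟨r, hr, q, hq, hqd⟩ := hex (t, v) hvw.symm hbv hbw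
    -- The triangle is flat, so its only point at distance `d` from the corner is the one on the
    -- side to be glued.
    obtain rfl : p = q := H.eq_of_dist_eq ⟨hvw, hc⟩ (hp.trans hqd.symm)
    have hinj {j k : Fin 4} (h : j ≠ k) : τ.perm t i j ≠ τ.perm t i k :=
      fun h' => h ((τ.perm t i).injective h')
    have hside := H.sidesMatch t v i w b hiv hvw.symm hiw.symm hbv hbi
    let q' : triangle z size (τ.adj t i, τ.perm t i v) :=
      ⟨_, mem_triangle_of_mem_side (hinj hvw.symm) (hinj hbv) hr⟩
    have hq' : dist (q' : ℂ) (corner z size (τ.adj t i, τ.perm t i v) (τ.perm t i w)) = d := by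
      rw [← hqd, hq]
      change dist (AffineMap.lineMap _ _ r) _ = _
      rw [dist_lineMap_left, dist_lineMap_left, hside]
    obtain rfl : p' = q' := H.eq_of_dist_eq
      ((τ.isAt_glue_iff κ hiv hiw).2 ⟨hvw, hc⟩) (hp'.trans hq'.symm)
    exact Quot.sound ⟨t, v, i, w, b, r, hiv, hvw.symm, hiw.symm, hbv, hbi, hbw.symm, hr, rfl,
      hq, rfl, rfl⟩
  | refl c => rw [H.eq_of_dist_eq ⟨c.2, hc⟩ (hp.trans hp'.symm)]
  | symm c c' h ih =>
    exact (ih ((Quot.eqvGen_sound h).trans hc) p' p hp' hp).symm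
  | trans c m c' h h' ih ih' =>
    obtain ⟨b, -, hb, -, hbw, -, -⟩ := Fin.exists_two_others m.1.2.1 m.1.2.2 m.2.symm
    obtain ⟨r, -, q, -, hqd⟩ := hex (m.1.1, m.1.2.1) m.2.symm hb hbw
    exact (ih hc p q hp hqd).trans (ih' ((Quot.eqvGen_sound h).symm.trans hc) q p' hqd hp')

/-- This is injectivity of the induced function on the neighbourhood of `κ` where it is less than
`δ`. -/
theorem mk_eq_of_vertexDist_eq {p q : TrianglePoint z size} (hp : τ.vertexDist z size κ δ p < δ)
    (hpq : τ.vertexDist z size κ δ p = τ.vertexDist z size κ δ q) :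
    (Quot.mk _ p : τ.CrossSection z size) = Quot.mk _ q := by
  obtain ⟨w, hw, hpd⟩ := exists_of_vertexDist_lt hp
  obtain ⟨w', hw', hqd⟩ := exists_of_vertexDist_lt (hpq ▸ hp)
  obtain ⟨x, p⟩ := p
  obtain ⟨y, q⟩ := q
  obtain ⟨hx, hxκ⟩ := hw
  obtain ⟨hy, hyκ⟩ := hw'
  exact H.mk_eq_of_dist_eq (c := ⟨(x.1, x.2, w), hx⟩) (c' := ⟨(y.1, y.2, w'), hy⟩)
    (by rw [← hpd]; exact dist_nonneg) hp (Quot.eqvGen_exact (hxκ.trans hyκ.symm)) hxκ p q hpd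
    (hqd.trans hpq.symm)

/-- The cross-section is not a surface near a vertex where all angles vanish. -/
theorem not_isClosedSurface : ¬ IsClosedSurface (τ.CrossSection z size) := by
  intro hX
  have hcont := continuous_quot_lift
    (fun p q h => H.vertexDist_eq_of_pointRel (p := p) (q := q) h)
    (τ.continuous_vertexDist z size κ δ)
  obtain ⟨⟨⟨t, v, w⟩, hvw⟩, hκ⟩ := Quot.exists_rep κ
  let p : TrianglePoint z size :=
    ⟨(t, v), corner z size (t, v) w, subset_convexHull ℝ _ ⟨w, Ne.symm hvw, rfl⟩⟩
  have hp : τ.vertexDist z size κ δ p < δ := by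
    classical
    refine lt_of_le_of_lt (ciInf_le (Finite.bddBelow_range _) w) ?_
    rw [if_pos ⟨hvw, hκ⟩, dist_self]
    exact min_lt_iff.2 (Or.inr H.pos)
  refine hX.not_injOn hcont (isOpen_Iio.preimage hcont)
    (x := Quot.mk _ p) (V := _ ⁻¹' Set.Iio δ) hp ?_
  intro a ha b _ hab
  induction a using Quot.ind with | _ a
  induction b using Quot.ind with | _ b
  exact H.mk_eq_of_vertexDist_eq ha hab

end IsThinVertex

/-! ### Completeness excludes angle sum zero -/

theorem exists_le_side_length [Finite T] (hz : ∀ t, IsShape (z t)) (hsize : ∀ x, 0 < size x) :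
    ∃ δ : ℝ, 0 < δ ∧ ∀ x a b, a ≠ x.2 → b ≠ x.2 → a ≠ b →
      δ ≤ dist (corner z size x a) (corner z size x b) := by
  classical
  rcases isEmpty_or_nonempty T with hT | hT
  · exact ⟨1, one_pos, fun x => hT.elim x.1⟩
  let P (y : (T × Fin 4) × Fin 4 × Fin 4) : Prop :=
    y.2.1 ≠ y.1.2 ∧ y.2.2 ≠ y.1.2 ∧ y.2.1 ≠ y.2.2
  -- The value `1` at triples that give no side only has to be positive.
  let f (y : (T × Fin 4) × Fin 4 × Fin 4) : ℝ :=
    if P y then dist (corner z size y.1 y.2.1) (corner z size y.1 y.2.2) else 1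
  obtain ⟨y, hy⟩ := Finite.exists_min f
  refine ⟨f y, ?_, fun x a b ha hb hab => (hy (x, a, b)).trans_eq (if_pos ⟨ha, hb, hab⟩)⟩
  by_cases h : P y
  · rw [show f y = _ from if_pos h]
    exact dist_pos.2 (cornerPos_ne (hz _) (hsize _) h.1 h.2.1 h.2.2)
  · rw [show f y = _ from if_neg h]
    exact one_pos

/-- If all angles around `e` were zero, an end of `e` would be a thin vertex, and the cross-section
could not be a surface. -/
theorem exists_arg_ne_zero [Fintype T] (hz : ∀ t, IsShape (z t)) (hcomplete : τ.IsComplete z)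
    (e : τ.Edge) : ∃ c ∈ τ.around e, (edgeParam (z c.1) c.2.1).arg ≠ 0 := by
  by_contra! h
  obtain ⟨size, hsize, hmatch, hX⟩ := hcomplete
  obtain ⟨δ, hδ, hle⟩ := exists_le_side_length hz hsize
  induction e using Quot.ind with | _ y
  obtain ⟨c, rfl⟩ := flagEdge_surjective y
  have H : τ.IsThinVertex z size (τ.toVertex c) δ :=
    { shape := hz
      sidesMatch := hmatch
      thin := by
        rintro x w ⟨hxw, hc⟩
        refine h (flagEdge ⟨(x.1, x.2, w), hxw⟩) ?_
        simp only [around, Finset.mem_filter, Finset.mem_univ, true_and]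
        exact congrArg τ.vertexEdge hc
      pos := hδ
      le_dist := hle }
  exact H.not_isClosedSurface hX

end IdealTriangulation

theorem lemma3p1 {T : Type*} [Fintype T] (τ : IdealTriangulation T) (hτ : τ.IsCusped)
    (z : T → ℂ) (hz : ∀ t, IsShape (z t))
    (hprod : ∀ e : τ.Edge, ∏ c ∈ τ.around e, edgeParam (z c.1) c.2.1 = 1)
    (hcomplete : τ.IsComplete z) (e : τ.Edge) :
    ∑ c ∈ τ.around e, Complex.arg (edgeParam (z c.1) c.2.1) = 2 * Real.pi :=
  τ.sum_arg_eq_two_pi (τ.card_edge hτ) hz hprod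
    (IdealTriangulation.exists_arg_ne_zero hz hcomplete) e
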